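/- For every $\gamma>0$ there is a constant $C>0$ depending only on $\gamma$ such that the following holds. Let $\Omega\subset\mathbb{R}^2$ be a bounded polygonal Lipschitz domain and let $T_h$ be a mesh of $\Omega$, that is, a finite set of closed nondegenerate triangles and parallelograms with pairwise disjoint interiors whose union is $\overline\Omega$. Let $h=\max_{K\in T_h}\operatorname{diam}K$, and let $T_h$ be quasi-uniform with constant $\gamma$: every $K\in T_h$ contains a ball of diameter at least $h/\gamma$. For a triangle $K$ put $V(K)=\mathrm{RT}_1(K)=P_1(K)^2+x\,P_1(K)$. For a parallelogram $K$ let $V(K)=\mathrm{BDFM}_2(K)$, the image under the Piola transform of the affine reference map of the space of all pairs $(q_1,q_2)$ of polynomials in $(s,t)$ of degree at most $2$ such that $q_1$ has no $t^2$ term and $q_2$ has no $s^2$ term. Let $$V_h=\{v_h\in H_0(\mathrm{div},\Omega):\ v_h|_K\in V(K)\ \text{ for all } K\in T_h\},$$ where $H_0(\mathrm{div},\Omega)$ consists of the fields $v\in L^2(\Omega)^2$ with $\operatorname{div}v\in L^2(\Omega)$ and $n\cdot v=0$ on $\partial\Omega$. For $K\in T_h$ with midpoint (barycenter) $m_K$,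 vertices $v_{K,i}$ and area $|K|$ set $$(f,g)_{h,K}=|K|\Big(\alpha\, f(m_K)\cdot g(m_K)+\sum_i\beta\, f(v_{K,i})\cdot g(v_{K,i})\Big),\qquad \sigma_K(f,g)=(f,g)_{h,K}-\int_K f\cdot g\,dx,$$ where $(\alpha,\beta)=(\tfrac34,\tfrac1{12})$ if $K$ is a triangle and $(\alpha,\beta)=(\tfrac23,\tfrac1{12})$ if $K$ is a parallelogram; point values at the vertices are taken from inside $K$. Let $\pi_h^1$ be the $L^2$-orthogonal projection onto the (discontinuous) piecewise affine vector fields on $T_h$. Let $u\in L^2(\Omega)^2$ with $u|_K\in H^1(K)^2$ for all $K\in T_h$. Then for all $v_h\in V_h$ and all $K\in T_h$ $$|\sigma_K(\pi_h^1u,v_h)|\le C\,h^2\,\|u\|_{H^1(K)}\,\|\operatorname{div}v_h\|_{L^2(K)}\quad\text{if } K \text{ is a triangle},$$ $$|\sigma_K(\pi_h^1u,v_h)|=0\quad\text{if } K \text{ is a parallelogram}.$$ -/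

import Mathlib

open MeasureTheory Set Metric
open scoped ContDiff RealInnerProductSpace

/-- The Euclidean plane `ℝ²`. -/
abbrev Plane := EuclideanSpace ℝ (Fin 2)

/-! ### Domains -/

/-- A Lipschitz domain: open, bounded, connected, nonempty, and near every boundary point it is,
in suitable Cartesian coordinates, the region strictly above the graph of a Lipschitz function. -/
def IsLipschitzDomain (Ω : Set Plane) : Prop :=
  IsOpen Ω ∧ Bornology.IsBounded Ω ∧ IsConnected Ω ∧
    ∀ x ∈ frontier Ω, ∃ e : Plane ≃ₗᵢ[ℝ] Plane, ∃ g : ℝ → ℝ, ∃ L : NNReal, LipschitzWith L g ∧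
      ∃ r : ℝ, 0 < r ∧ ∀ y ∈ ball x r, y ∈ Ω ↔ g (e y 0) < e y 1

/-- A bounded polygonal Lipschitz domain: a Lipschitz domain whose boundary is covered by
finitely many line segments. -/
def IsPolygonalLipschitzDomain (Ω : Set Plane) : Prop :=
  IsLipschitzDomain Ω ∧
    ∃ S : Finset (Plane × Plane), frontier Ω ⊆ ⋃ s ∈ S, segment ℝ s.1 s.2

/-! ### Cells and meshes -/

/-- A nondegenerate triangle with vertices `p 0, p 1, p 2`, or a nondegenerate parallelogram with
vertices `o, o + a, o + b, o + a + b`. -/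
inductive Cell where
  | triangle (p : Fin 3 → Plane) (hp : AffineIndependent ℝ p)
  | parallelogram (o a b : Plane) (hab : LinearIndependent ℝ ![a, b])

namespace Cell

/-- The closed point set `K` of the cell. -/
def carrier : Cell → Set Plane
  | triangle p _ => convexHull ℝ (range p)
  | parallelogram o a b _ =>
      {x | ∃ s ∈ Icc (0 : ℝ) 1, ∃ t ∈ Icc (0 : ℝ) 1, x = o + s • a + t • b}

/-- The area `|K|`. -/
noncomputable def area (K : Cell) : ℝ := volume.real K.carrier

/-- The diameter of `K`. -/
noncomputable def diam (K : Cell) : ℝ := Metric.diam K.carrier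

/-- The local space `V(K)` of vector fields. The elements are polynomial fields, regarded as
functions on the whole plane.
* Triangle: `RT₁(K) = P₁(K)² + x P₁(K)`.
* Parallelogram: `BDFM₂(K)`, the image under the Piola transform of the affine map
  `(s, t) ↦ o + s a + t b` of the reference space of all pairs `(q₁, q₂)` of polynomials of degree
  at most two such that `q₁` has no term `t²` and `q₂` has no term `s²`. (The constant Jacobian
  factor of the Piola transform does not change the space.) -/
def space : Cell → Set (Plane → Plane)
  | triangle _ _ =>
      {v | ∃ (A : Plane →ᵃ[ℝ] Plane) (l : Plane →ᵃ[ℝ] ℝ), ∀ x, v x = A x + l x • x}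
  | parallelogram o a b _ =>
      {v | ∃ c d : Fin 5 → ℝ, ∀ s t : ℝ, v (o + s • a + t • b) =
        (c 0 + c 1 * s + c 2 * t + c 3 * s ^ 2 + c 4 * (s * t)) • a +
        (d 0 + d 1 * s + d 2 * t + d 3 * t ^ 2 + d 4 * (s * t)) • b}

/-- The lumped scalar product `(f, g)_{h,K}`, i.e. `|K| (α f(m)·g(m) + ∑ᵢ β f(vᵢ)·g(vᵢ))` with `m`
the midpoint and `vᵢ` the vertices of `K`; `(α, β) = (3/4, 1/12)` on triangles and
`(2/3, 1/12)` on parallelograms. -/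
noncomputable def lumped (K : Cell) (f g : Plane → Plane) : ℝ :=
  match K with
  | triangle p hp =>
      (triangle p hp).area *
        (3 / 4 * ⟪f ((1 / 3 : ℝ) • (p 0 + p 1 + p 2)), g ((1 / 3 : ℝ) • (p 0 + p 1 + p 2))⟫ +
          ∑ i, 1 / 12 * ⟪f (p i), g (p i)⟫)
  | parallelogram o a b hab =>
      (parallelogram o a b hab).area *
        (2 / 3 * ⟪f (o + (1 / 2 : ℝ) • (a + b)), g (o + (1 / 2 : ℝ) • (a + b))⟫ +
          (1 / 12 * ⟪f o, g o⟫ + 1 / 12 * ⟪f (o + a), g (o + a)⟫ +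
            1 / 12 * ⟪f (o + b), g (o + b)⟫ + 1 / 12 * ⟪f (o + a + b), g (o + a + b)⟫))

/-- The quadrature error `σ_K(f, g) = (f, g)_{h,K} - (f, g)_K`. -/
noncomputable def sigma (K : Cell) (f g : Plane → Plane) : ℝ :=
  K.lumped f g - ∫ x in K.carrier, ⟪f x, g x⟫

/-- `p` is the `L²(K)`-orthogonal projection of `u` onto `P₁(K)²`. -/
def IsL2Proj (K : Cell) (u : Plane → Plane) (p : Plane →ᵃ[ℝ] Plane) : Prop :=
  ∀ q : Plane →ᵃ[ℝ] Plane, ∫ x in K.carrier, ⟪u x - p x, q x⟫ = 0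

open Classical in
/-- The `L²(K)`-orthogonal projection `π¹_K u` of `u ∈ L²(K)²` onto `P₁(K)²`, as an affine map
(the value for `u` not in `L²(K)²` is irrelevant). -/
noncomputable def l2Proj (K : Cell) (u : Plane → Plane) : Plane →ᵃ[ℝ] Plane :=
  if h : ∃ p, K.IsL2Proj u p then h.choose else 0

theorem isCompact_carrier (K : Cell) : IsCompact K.carrier := by
  cases K with
  | triangle p hp => exact (finite_range p).isCompact_convexHull ℝ
  | parallelogram o a b hab =>
    have h : carrier (parallelogram o a b hab) =
        (fun z : ℝ × ℝ => o + z.1 • a + z.2 • b) '' (Icc (0 : ℝ) 1 ×ˢ Icc (0 : ℝ) 1) := by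
      ext x
      simp only [carrier, mem_ofPred_eq, mem_image, mem_prod, Prod.exists]
      constructor
      · rintro ⟨s, hs, t, ht, rfl⟩
        exact ⟨s, t, ⟨hs, ht⟩, rfl⟩
      · rintro ⟨s, t, ⟨hs, ht⟩, rfl⟩
        exact ⟨s, hs, t, ht, rfl⟩
    rw [h]
    exact (isCompact_Icc.prod isCompact_Icc).image (by fun_prop)

theorem memLp_affine (K : Cell) (p : Plane →ᵃ[ℝ] Plane) :
    MemLp p 2 (volume.restrict K.carrier) := by
  have hc : Continuous p := p.continuous_of_finiteDimensional
  have hK := K.isCompact_carrier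
  have : IsFiniteMeasure (volume.restrict K.carrier) :=
    ⟨by simpa using hK.measure_lt_top⟩
  obtain ⟨C, hC⟩ := hK.exists_bound_of_continuousOn hc.continuousOn
  exact MemLp.of_bound hc.aestronglyMeasurable C
    ((ae_restrict_iff' hK.measurableSet).2 (Filter.Eventually.of_forall hC))

/-- The projection exists for every square integrable field. -/
theorem exists_isL2Proj (K : Cell) (u : Plane → Plane)
    (hu : MemLp u 2 (volume.restrict K.carrier)) : ∃ p, K.IsL2Proj u p := by
  have : FiniteDimensional ℝ (Plane →ᵃ[ℝ] Plane) :=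
    Module.Finite.equiv (AffineMap.toConstProdLinearMap (R := ℝ) (V1 := Plane) (V2 := Plane)).symm
  let L : (Plane →ᵃ[ℝ] Plane) →ₗ[ℝ] Lp Plane 2 (volume.restrict K.carrier) :=
    { toFun := fun p => (K.memLp_affine p).toLp p
      map_add' := fun p q => rfl
      map_smul' := fun c p => rfl }
  obtain ⟨p, hp⟩ := (LinearMap.range L).starProjection_apply_mem (hu.toLp u)
  refine ⟨p, fun q => ?_⟩
  have h := (LinearMap.range L).starProjection_inner_eq_zero (hu.toLp u) (L q) ⟨q, rfl⟩
  rw [← hp, L2.inner_def] at h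
  rw [← h]
  refine integral_congr_ae ?_
  filter_upwards [hu.coeFn_toLp, (K.memLp_affine p).coeFn_toLp, (K.memLp_affine q).coeFn_toLp,
    Lp.coeFn_sub (hu.toLp u) (L p)] with x h1 h2 h3 h4
  rw [h4, Pi.sub_apply, h1]
  change _ = ⟪u x - ((K.memLp_affine p).toLp p) x, ((K.memLp_affine q).toLp q) x⟫
  rw [h2, h3]

end Cell

/-- The mesh size `h`, the largest diameter of a cell. -/
noncomputable def meshSize (T : Finset Cell) : ℝ := ⨆ K : {K // K ∈ T}, K.1.diam

/-- `T` is a finite mesh of `Ω`: the closed cells cover the closure of `Ω` exactly and have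
pairwise disjoint interiors (no further matching condition is needed). -/
def IsMesh (Ω : Set Plane) (T : Finset Cell) : Prop :=
  (⋃ K ∈ T, K.carrier) = closure Ω ∧
    ∀ K ∈ T, ∀ K' ∈ T, K ≠ K' → Disjoint (interior K.carrier) (interior K'.carrier)

/-- Quasi-uniformity with constant `γ`: every cell contains a ball whose diameter is at least
`h / γ`. -/
def IsQuasiUniform (γ : ℝ) (T : Finset Cell) : Prop :=
  ∀ K ∈ T, ∃ x r, 0 < r ∧ ball x r ⊆ K.carrier ∧ meshSize T ≤ γ * (2 * r)

/-! ### Function spaces -/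

/-- Smooth compactly supported scalar functions on the plane. -/
def IsTest (φ : Plane → ℝ) : Prop := ContDiff ℝ ∞ φ ∧ HasCompactSupport φ

/-- `g` is the weak gradient of the scalar function `f` on the open set `U`. -/
def HasWeakGrad (U : Set Plane) (f : Plane → ℝ) (g : Plane → Plane) : Prop :=
  ∀ φ, IsTest φ → tsupport φ ⊆ U → ∀ e : Plane,
    ∫ x in U, f x * fderiv ℝ φ x e = - ∫ x in U, ⟪g x, e⟫ * φ x

/-- `f ∈ H¹(U)`: `f` and its weak gradient are square integrable. -/
def MemH1 (U : Set Plane) (f : Plane → ℝ) : Prop :=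
  MemLp f 2 (volume.restrict U) ∧
    ∃ g, MemLp g 2 (volume.restrict U) ∧ HasWeakGrad U f g

open Classical in
/-- The weak gradient of `f ∈ H¹(U)` (zero if `f ∉ H¹(U)`). -/
noncomputable def weakGrad (U : Set Plane) (f : Plane → ℝ) : Plane → Plane :=
  if h : MemH1 U f then h.2.choose else 0

/-- `u ∈ H¹(U)²`. -/
def MemH1Vec (U : Set Plane) (u : Plane → Plane) : Prop := ∀ i, MemH1 U (fun x => u x i)

/-- The norm of `H¹(U)²`: `‖u‖² = ∑ᵢ (‖uᵢ‖²_{L²(U)} + ‖∇uᵢ‖²_{L²(U)})`. -/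
noncomputable def h1Norm (U : Set Plane) (u : Plane → Plane) : ℝ :=
  √(∑ i, ((∫ x in U, (u x i) ^ 2) + ∫ x in U, ‖weakGrad U (fun y => u y i) x‖ ^ 2))

/-- The norm of `L²(K)` of a scalar function. -/
noncomputable def l2Norm (K : Set Plane) (f : Plane → ℝ) : ℝ := √(∫ x in K, (f x) ^ 2)

/-- The classical divergence, i.e. the trace of the derivative. -/
noncomputable def divergence (v : Plane → Plane) (x : Plane) : ℝ :=
  ∑ i, fderiv ℝ v x (EuclideanSpace.single i 1) i

/-- `d` is the weak divergence of `v` on the open set `U`. -/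
def HasWeakDiv (U : Set Plane) (v : Plane → Plane) (d : Plane → ℝ) : Prop :=
  ∀ φ, IsTest φ → tsupport φ ⊆ U →
    ∫ x in U, fderiv ℝ φ x (v x) = - ∫ x in U, d x * φ x

/-- `v ∈ H₀(div, Ω)`: `v` and its weak divergence `d` are square integrable, and the normal trace
of `v` vanishes on the boundary, i.e. Green's formula `(v, ∇φ) + (div v, φ) = 0` holds without a
boundary term for all functions `φ` that are smooth up to the boundary. -/
def MemH0Div (Ω : Set Plane) (v : Plane → Plane) : Prop :=
  MemLp v 2 (volume.restrict Ω) ∧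
    ∃ d, MemLp d 2 (volume.restrict Ω) ∧ HasWeakDiv Ω v d ∧
      ∀ φ, IsTest φ → (∫ x in Ω, fderiv ℝ φ x (v x)) + ∫ x in Ω, d x * φ x = 0

/-- `v_h ∈ V_h`: `v_h ∈ H₀(div, Ω)` and `v_h|_K ∈ V(K)` for all cells `K`. As `v_h` is an element
of `L²`, the latter means that `v_h` coincides with an element of `V(K)` almost everywhere on
`K`. -/
def MemVh (Ω : Set Plane) (T : Finset Cell) (v : Plane → Plane) : Prop :=
  MemH0Div Ω v ∧ ∀ K ∈ T, ∃ p ∈ K.space, v =ᵐ[volume.restrict K.carrier] p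

open Classical in
/-- The restriction `v_h|_K` as an element of `V(K)`. Its values at the vertices of `K` are the
traces taken from inside of `K`. (It is zero if there is no such element.) -/
noncomputable def Cell.restr (K : Cell) (v : Plane → Plane) : Plane → Plane :=
  if h : ∃ p ∈ K.space, v =ᵐ[volume.restrict K.carrier] p then h.choose else 0

/-! On a triangle the rule is exact for quadratics. Write the projection of `u` as an affine field
`A`, the discrete field as `B + l x`, and the midpoint as `m`. Up to quadratics, `A · (B + l x)`
equals the centered cubic `(l - l(m)) (A - A(m)) · (x - m)` (`triError_inner_raviartThomas`), so it
suffices to bound three factors. First, `|x - m| ≤ h`. Second, `div (B + l x)` is `3 l` plus a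
constant, so exactness of the rule on its square bounds `l - l(m)` by `|K|^(-1/2) ‖div‖`
(`sq_sub_triMid_le`). Third, `A - A(m)` is bounded by `h |K|^(-1/2) ‖∇u‖`
(`sq_affine_sub_le_weakGrad`). The powers of `|K|` cancel against the weight of the rule.

The third bound uses neither a Poincaré inequality nor a reference triangle. The field `λ_i λ_j (b_j
- b_i)` has zero normal component on the boundary and divergence `λ_i - λ_j`, so Green's formula
turns the moment of `u` against `λ_i - λ_j` into an integral of `∇u`
(`integral_mul_coord_sub_coord`). The projection has the same moment, and for an affine function
that moment is `|K| / 12` times a difference of vertex values. The same formula with affine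
functions also yields all moments of `λ_i λ_j`, hence the exactness of the rule.

On a parallelogram, affine times quadratic is cubic, and the rule is exact for cubics. -/

/-! ### A smooth truncation of the identity -/

/-- A smooth function that vanishes on `(-∞, 1]` and is the identity on `[2, ∞)`. -/
noncomputable def cutId (s : ℝ) : ℝ := s * Real.smoothTransition (s - 1)

theorem contDiff_cutId : ContDiff ℝ ∞ cutId :=
  contDiff_id.mul (Real.smoothTransition.contDiff.comp (contDiff_id.sub contDiff_const))

theorem cutId_of_le {s : ℝ} (hs : s ≤ 1) : cutId s = 0 := by
  simp [cutId, Real.smoothTransition.zero_of_nonpos (sub_nonpos.2 hs)]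

theorem cutId_of_ge {s : ℝ} (hs : 2 ≤ s) : cutId s = s := by
  simp [cutId, Real.smoothTransition.one_of_one_le (by linarith : (1 : ℝ) ≤ s - 1)]

theorem abs_cutId_le (s : ℝ) : |cutId s| ≤ |s| := by
  rw [cutId, abs_mul, abs_of_nonneg (Real.smoothTransition.nonneg _)]
  exact mul_le_of_le_one_right (abs_nonneg _) (Real.smoothTransition.le_one _)

theorem deriv_cutId_of_lt {s : ℝ} (hs : s < 1) : deriv cutId s = 0 := by
  have h : cutId =ᶠ[nhds s] fun _ => 0 := by
    filter_upwards [Iio_mem_nhds hs] with x hx using cutId_of_le (le_of_lt hx)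
  rw [h.deriv_eq, deriv_const]

theorem deriv_cutId_of_gt {s : ℝ} (hs : 2 < s) : deriv cutId s = 1 := by
  have h : cutId =ᶠ[nhds s] id := by
    filter_upwards [Ioi_mem_nhds hs] with x hx using cutId_of_ge (le_of_lt hx)
  rw [h.deriv_eq, deriv_id]

/-- The derivative of `cutId (N s) / N` in `s` is `deriv cutId (N s)`, so `M` bounds it uniformly in
`N`. This makes dominated convergence possible as `N → ∞`. -/
theorem exists_bound_deriv_cutId : ∃ M : ℝ, 1 ≤ M ∧ ∀ s, |deriv cutId s| ≤ M := by
  have hc : Continuous (deriv cutId) := contDiff_cutId.continuous_deriv (by simp)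
  obtain ⟨M, hM⟩ := (isCompact_Icc (a := (1 : ℝ)) (b := 2)).exists_bound_of_continuousOn
    hc.continuousOn
  refine ⟨max M 1, le_max_right _ _, fun s => ?_⟩
  by_cases h1 : s < 1
  · simp [deriv_cutId_of_lt h1]
  by_cases h2 : 2 < s
  · simp [deriv_cutId_of_gt h2]
  · exact (hM s ⟨not_lt.1 h1, not_lt.1 h2⟩).trans (le_max_left _ _)

/-! ### Test functions on a triangle -/

/-- The test functions `φ_N` which approximate `λ_i λ_j` inside of a triangle; the cutoff in the
third barycentric coordinate `λ_k` is constant along the edge `ij`. -/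
noncomputable def edgeTest (b : AffineBasis (Fin 3) ℝ Plane) (i j k : Fin 3) (N : ℝ)
    (x : Plane) : ℝ :=
  Real.smoothTransition (N * b.coord k x - 1) *
    (cutId (N * b.coord i x) / N * (cutId (N * b.coord j x) / N))

theorem AffineMap.hasFDerivAt_plane {F : Type*} [NormedAddCommGroup F] [NormedSpace ℝ F]
    (a : Plane →ᵃ[ℝ] F) (x : Plane) :
    HasFDerivAt a (LinearMap.toContinuousLinearMap a.linear) x := by
  have h : (a : Plane → F) = fun x => LinearMap.toContinuousLinearMap a.linear x + a 0 := by
    funext x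
    rw [a.decomp]
    simp
  rw [h]
  exact (LinearMap.toContinuousLinearMap a.linear).hasFDerivAt.add_const _

theorem AffineMap.contDiff_plane {F : Type*} [NormedAddCommGroup F] [NormedSpace ℝ F]
    (a : Plane →ᵃ[ℝ] F) : ContDiff ℝ ∞ a := by
  rw [a.decomp]
  exact (LinearMap.toContinuousLinearMap a.linear).contDiff.add contDiff_const

theorem contDiff_coord (b : AffineBasis (Fin 3) ℝ Plane) (i : Fin 3) :
    ContDiff ℝ ∞ (b.coord i) := (b.coord i).contDiff_plane

theorem continuous_coord (b : AffineBasis (Fin 3) ℝ Plane) (i : Fin 3) :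
    Continuous (b.coord i) := (contDiff_coord b i).continuous

theorem coord_add_smul (b : AffineBasis (Fin 3) ℝ Plane) (l i j : Fin 3) (x : Plane) (r : ℝ) :
    b.coord l (x + r • (b j - b i)) = b.coord l x + r * (b.coord l (b j) - b.coord l (b i)) := by
  rw [add_comm x, ← vadd_eq_add, AffineMap.map_vadd, map_smul, ← vsub_eq_sub (b j) (b i),
    AffineMap.linearMap_vsub]
  simp [add_comm]

theorem contDiff_edgeTest (b : AffineBasis (Fin 3) ℝ Plane) (i j k : Fin 3) (N : ℝ) :
    ContDiff ℝ ∞ (edgeTest b i j k N) := by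
  have h (l) : ContDiff ℝ ∞ fun x => N * b.coord l x := contDiff_const.mul (contDiff_coord b l)
  exact (Real.smoothTransition.contDiff.comp ((h k).sub contDiff_const)).mul
    (((contDiff_cutId.comp (h i)).div_const N).mul ((contDiff_cutId.comp (h j)).div_const N))

/-- All three cutoffs vanish as soon as their argument `N λ_l` is at most `1`, so the support stays
away from all three edges. -/
theorem tsupport_edgeTest_subset (b : AffineBasis (Fin 3) ℝ Plane) {i j k : Fin 3}
    (hijk : ∀ l, l = i ∨ l = j ∨ l = k) {N : ℝ} (hN : 0 < N) :
    tsupport (edgeTest b i j k N) ⊆ {x | ∀ l, 1 / N ≤ b.coord l x} := by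
  refine closure_minimal (fun x hx => ?_) ?_
  · by_contra hcon
    simp only [mem_ofPred_eq, not_forall, not_le] at hcon
    obtain ⟨l, hl⟩ := hcon
    rw [lt_div_iff₀ hN, mul_comm] at hl
    apply hx
    rcases hijk l with rfl | rfl | rfl
    · simp [edgeTest, cutId_of_le hl.le]
    · simp [edgeTest, cutId_of_le hl.le]
    · simp [edgeTest, Real.smoothTransition.zero_of_nonpos (sub_nonpos.2 hl.le)]
  · simp only [ofPred_forall]
    exact isClosed_iInter fun l => isClosed_le continuous_const (continuous_coord b l)

theorem isTest_edgeTest (b : AffineBasis (Fin 3) ℝ Plane) {i j k : Fin 3}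
    (hijk : ∀ l, l = i ∨ l = j ∨ l = k) {N : ℝ} (hN : 0 < N) :
    IsTest (edgeTest b i j k N) ∧
      tsupport (edgeTest b i j k N) ⊆ interior (convexHull ℝ (range b)) := by
  have hs := tsupport_edgeTest_subset b hijk hN
  have hpos : 0 < 1 / N := by positivity
  refine ⟨⟨contDiff_edgeTest b i j k N, ?_⟩, ?_⟩
  · refine ((finite_range b).isCompact_convexHull ℝ).of_isClosed_subset (isClosed_tsupport _)
      (hs.trans fun x hx => ?_)
    rw [AffineBasis.convexHull_eq_nonneg_coord]
    exact fun l => hpos.le.trans (hx l)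
  · rw [AffineBasis.interior_convexHull]
    exact hs.trans fun x hx l => hpos.trans_le (hx l)

/-- Moving along `b j - b i` leaves `λ_k` fixed, so the cutoff in `λ_k`, whose gradient has size
`N`, is never differentiated. Only derivatives of `cutId` appear, and these are bounded in `N`. -/
theorem fderiv_edgeTest (b : AffineBasis (Fin 3) ℝ Plane) {i j k : Fin 3} (hij : i ≠ j)
    (hik : i ≠ k) (hjk : j ≠ k) {N : ℝ} (hN : 0 < N) (x : Plane) :
    fderiv ℝ (edgeTest b i j k N) x (b j - b i) =
      Real.smoothTransition (N * b.coord k x - 1) *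
        (-deriv cutId (N * b.coord i x) * (cutId (N * b.coord j x) / N) +
          cutId (N * b.coord i x) / N * deriv cutId (N * b.coord j x)) := by
  have hd : DifferentiableAt ℝ (edgeTest b i j k N) x :=
    (contDiff_edgeTest b i j k N).contDiffAt.differentiableAt (by simp)
  have hc (s : ℝ) : HasDerivAt cutId (deriv cutId s) s :=
    (contDiff_cutId.contDiffAt.differentiableAt (by simp)).hasDerivAt
  rw [← hd.lineDeriv_eq_fderiv]
  refine HasLineDerivAt.lineDeriv ?_
  unfold HasLineDerivAt
  have hcut (l : Fin 3) (c : ℝ) (h : b.coord l (b j) - b.coord l (b i) = c) :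
      HasDerivAt (fun r : ℝ => cutId (N * b.coord l (x + r • (b j - b i))) / N)
        (deriv cutId (N * b.coord l x) * c) 0 := by
    have h1 : HasDerivAt (fun r : ℝ => N * (b.coord l x + r * c)) (N * c) 0 := by
      simpa using (((hasDerivAt_id (0 : ℝ)).mul_const c).const_add (b.coord l x)).const_mul N
    have h2 := (HasDerivAt.comp (0 : ℝ) (h := fun r : ℝ => N * (b.coord l x + r * c)) (hc _)
      h1).div_const N
    simp only [coord_add_smul, h]
    convert! h2 using 1
    simp only [zero_mul, add_zero]
    field_simp
  have hk : (fun r : ℝ => edgeTest b i j k N (x + r • (b j - b i))) = fun r : ℝ =>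
      Real.smoothTransition (N * b.coord k x - 1) *
        (cutId (N * b.coord i (x + r • (b j - b i))) / N *
          (cutId (N * b.coord j (x + r • (b j - b i))) / N)) := by
    funext r
    rw [edgeTest, coord_add_smul b k, b.coord_apply_ne hik.symm, b.coord_apply_ne hjk.symm]
    simp
  rw [hk]
  -- Along `b j - b i` the coordinate `λ_i` has slope `-1` and `λ_j` has slope `1`.
  have := ((hcut i (-1) (by simp [b.coord_apply_ne hij])).mul
    (hcut j 1 (by simp [b.coord_apply_ne hij.symm]))).const_mul
      (Real.smoothTransition (N * b.coord k x - 1))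
  convert! this using 1
  simp

/-! ### Integration by parts along an edge -/

theorem coord_mem_of_mem_interior (b : AffineBasis (Fin 3) ℝ Plane) {x : Plane}
    (hx : x ∈ interior (convexHull ℝ (range b))) (i : Fin 3) :
    0 < b.coord i x ∧ b.coord i x ≤ 1 := by
  rw [AffineBasis.interior_convexHull] at hx
  refine ⟨hx i, ?_⟩
  rw [← b.sum_coord_apply_eq_one x]
  exact Finset.single_le_sum (f := fun i => b.coord i x) (fun j _ => (hx j).le)
    (Finset.mem_univ i)

theorem isFiniteMeasure_interior_triangle (b : AffineBasis (Fin 3) ℝ Plane) :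
    IsFiniteMeasure (volume.restrict (interior (convexHull ℝ (range b)))) :=
  ⟨by
    rw [Measure.restrict_apply_univ]
    exact (measure_mono interior_subset).trans_lt
      ((finite_range b).isCompact_convexHull ℝ).measure_lt_top⟩

theorem abs_cutId_div_le {N s : ℝ} (hN : 0 < N) (hs : 0 < s) (hs1 : s ≤ 1) :
    |cutId (N * s) / N| ≤ 1 := by
  rw [abs_div, abs_of_pos hN, div_le_one hN]
  refine (abs_cutId_le _).trans ?_
  rw [abs_of_pos (by positivity)]
  nlinarith

/-- Green's formula for the field `λ_i λ_j (b_j - b_i)`, whose normal component vanishes on the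
boundary of the triangle, tested with a function that has a weak gradient. -/
theorem integral_mul_coord_sub_coord (b : AffineBasis (Fin 3) ℝ Plane) {f : Plane → ℝ}
    {g : Plane → Plane}
    (hf : MemLp f 2 (volume.restrict (interior (convexHull ℝ (range b)))))
    (hg : MemLp g 2 (volume.restrict (interior (convexHull ℝ (range b)))))
    (hfg : HasWeakGrad (interior (convexHull ℝ (range b))) f g) {i j : Fin 3} (hij : i ≠ j) :
    ∫ x in interior (convexHull ℝ (range b)), f x * (b.coord i x - b.coord j x) =
      -∫ x in interior (convexHull ℝ (range b)),
        ⟪g x, b j - b i⟫ * (b.coord i x * b.coord j x) := by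
  obtain ⟨k, hik, hjk, hijk⟩ : ∃ k, i ≠ k ∧ j ≠ k ∧ ∀ l, l = i ∨ l = j ∨ l = k := by
    revert i j
    decide
  have := isFiniteMeasure_interior_triangle b
  set U := interior (convexHull ℝ (range b)) with hU
  obtain ⟨M, hM1, hM⟩ := exists_bound_deriv_cutId
  have hN (n : ℕ) : (0 : ℝ) < n + 1 := by positivity
  -- At a fixed interior point every cutoff is eventually inactive, so both integrands below are
  -- eventually constant in `n`.
  have hlim {x : Plane} (hx : x ∈ U) (l : Fin 3) : ∀ᶠ n : ℕ in Filter.atTop,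
      2 < ((n : ℝ) + 1) * b.coord l x := by
    have h0 := (coord_mem_of_mem_interior b hx l).1
    have : Filter.Tendsto (fun n : ℕ => ((n : ℝ) + 1) * b.coord l x) Filter.atTop Filter.atTop :=
      (Filter.tendsto_atTop_add_const_right _ _ tendsto_natCast_atTop_atTop).atTop_mul_const h0
    exact this.eventually_gt_atTop 2
  have hmU : ∀ᵐ x ∂volume.restrict U, x ∈ U := ae_restrict_mem isOpen_interior.measurableSet
  have hfi : Integrable f (volume.restrict U) := hf.integrable (by norm_num)
  have hgi : Integrable g (volume.restrict U) := hg.integrable (by norm_num)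
  have key (n : ℕ) := hfg (edgeTest b i j k (n + 1)) (isTest_edgeTest b hijk (hN n)).1
    (isTest_edgeTest b hijk (hN n)).2 (b j - b i)
  have hS (s : ℝ) : |Real.smoothTransition s| ≤ 1 := by
    rw [abs_of_nonneg (Real.smoothTransition.nonneg _)]
    exact Real.smoothTransition.le_one _
  have hleft : Filter.Tendsto
      (fun n : ℕ => ∫ x in U, f x * fderiv ℝ (edgeTest b i j k (n + 1)) x (b j - b i))
      Filter.atTop (nhds (∫ x in U, f x * (b.coord i x - b.coord j x))) := by
    refine tendsto_integral_of_dominated_convergence (fun x => |f x| * (2 * M)) ?_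
      (hfi.abs.mul_const _) ?_ ?_
    · intro n
      refine hf.1.mul (Continuous.aestronglyMeasurable ?_)
      exact ((contDiff_edgeTest b i j k (n + 1)).continuous_fderiv (by simp)).clm_apply
        continuous_const
    · intro n
      filter_upwards [hmU] with x hx
      rw [fderiv_edgeTest b hij hik hjk (hN n), Real.norm_eq_abs, abs_mul]
      refine mul_le_mul_of_nonneg_left ?_ (abs_nonneg _)
      have hi := coord_mem_of_mem_interior b hx i
      have hj := coord_mem_of_mem_interior b hx j
      have h1 : |-deriv cutId ((n + 1) * b.coord i x) *
          (cutId ((n + 1) * b.coord j x) / (n + 1))| ≤ M * 1 := by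
        rw [abs_mul, abs_neg]
        exact mul_le_mul (hM _) (abs_cutId_div_le (hN n) hj.1 hj.2) (abs_nonneg _) (by linarith)
      have h2 : |cutId ((n + 1) * b.coord i x) / (n + 1) *
          deriv cutId ((n + 1) * b.coord j x)| ≤ 1 * M := by
        rw [abs_mul]
        exact mul_le_mul (abs_cutId_div_le (hN n) hi.1 hi.2) (hM _) (abs_nonneg _) (by linarith)
      rw [abs_mul]
      refine (mul_le_of_le_one_left (abs_nonneg _) (hS _)).trans ?_
      exact (abs_add_le _ _).trans (by linarith)
    · filter_upwards [hmU] with x hx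
      refine tendsto_const_nhds.congr' ?_
      filter_upwards [hlim hx i, hlim hx j, hlim hx k] with n h1 h2 h3
      rw [fderiv_edgeTest b hij hik hjk (hN n), deriv_cutId_of_gt h1, deriv_cutId_of_gt h2,
        cutId_of_ge h1.le, cutId_of_ge h2.le, Real.smoothTransition.one_of_one_le (by linarith)]
      have := (hN n).ne'
      field_simp
      ring
  have hright : Filter.Tendsto
      (fun n : ℕ => ∫ x in U, ⟪g x, b j - b i⟫ * edgeTest b i j k (n + 1) x)
      Filter.atTop (nhds (∫ x in U, ⟪g x, b j - b i⟫ * (b.coord i x * b.coord j x))) := by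
    have hgt : Integrable (fun x => ⟪g x, b j - b i⟫) (volume.restrict U) := hgi.inner_const _
    refine tendsto_integral_of_dominated_convergence (fun x => |⟪g x, b j - b i⟫|) ?_
      hgt.abs ?_ ?_
    · intro n
      exact hgt.1.mul (contDiff_edgeTest b i j k (n + 1)).continuous.aestronglyMeasurable
    · intro n
      filter_upwards [hmU] with x hx
      have hi := coord_mem_of_mem_interior b hx i
      have hj := coord_mem_of_mem_interior b hx j
      rw [Real.norm_eq_abs, abs_mul, edgeTest, abs_mul, abs_mul]
      refine mul_le_of_le_one_right (abs_nonneg _) ?_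
      exact mul_le_one₀ (hS _) (by positivity) (mul_le_one₀
        (abs_cutId_div_le (hN n) hi.1 hi.2) (abs_nonneg _)
        (abs_cutId_div_le (hN n) hj.1 hj.2))
    · filter_upwards [hmU] with x hx
      refine tendsto_const_nhds.congr' ?_
      filter_upwards [hlim hx i, hlim hx j, hlim hx k] with n h1 h2 h3
      rw [edgeTest, cutId_of_ge h1.le, cutId_of_ge h2.le,
        Real.smoothTransition.one_of_one_le (by linarith)]
      have := (hN n).ne'
      field_simp
  refine tendsto_nhds_unique hleft ?_
  simp only [key]
  exact hright.neg

/-! ### Moments of the barycentric coordinates -/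

/-- The gradient of an affine function. -/
noncomputable def affineGrad (a : Plane →ᵃ[ℝ] ℝ) : Plane :=
  (InnerProductSpace.toDual ℝ Plane).symm (LinearMap.toContinuousLinearMap a.linear)

theorem inner_affineGrad (a : Plane →ᵃ[ℝ] ℝ) (e : Plane) : ⟪affineGrad a, e⟫ = a.linear e := by
  simp [affineGrad]

/-- Test functions vanish off `U`, so both integrals extend to the whole plane, where integration by
parts has no boundary term. -/
theorem hasWeakGrad_affine (U : Set Plane) (a : Plane →ᵃ[ℝ] ℝ) :
    HasWeakGrad U a (fun _ => affineGrad a) := by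
  intro φ hφ hU e
  have hd : Continuous fun x => fderiv ℝ φ x e :=
    (hφ.1.continuous_fderiv (by simp)).clm_apply continuous_const
  have hds : HasCompactSupport fun x => fderiv ℝ φ x e := hφ.2.fderiv_apply (𝕜 := ℝ) e
  have hz (x : Plane) (hx : x ∉ U) : φ x = 0 := image_eq_zero_of_notMem_tsupport fun h => hx (hU h)
  have hz' (x : Plane) (hx : x ∉ U) : fderiv ℝ φ x e = 0 := by
    have : fderiv ℝ φ x = 0 := by
      by_contra h
      exact hx (hU (support_fderiv_subset ℝ h))
    simp [this]
  have ha : Continuous a := a.contDiff_plane.continuous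
  have hfd (x : Plane) : fderiv ℝ a x e = ⟪affineGrad a, e⟫ := by
    rw [(a.hasFDerivAt_plane x).fderiv, inner_affineGrad]
    rfl
  rw [setIntegral_eq_integral_of_forall_compl_eq_zero fun x hx => by rw [hz' x hx, mul_zero],
    setIntegral_eq_integral_of_forall_compl_eq_zero fun x hx => by rw [hz x hx, mul_zero],
    integral_mul_fderiv_eq_neg_fderiv_mul_of_integrable]
  · simp only [hfd]
  · simp only [hfd]
    exact (continuous_const.mul hφ.1.continuous).integrable_of_hasCompactSupport hφ.2.mul_left
  · exact (ha.mul hd).integrable_of_hasCompactSupport hds.mul_left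
  · exact (ha.mul hφ.1.continuous).integrable_of_hasCompactSupport hφ.2.mul_left
  · exact fun x _ => (a.hasFDerivAt_plane x).differentiableAt
  · exact fun x _ => hφ.1.contDiffAt.differentiableAt (by simp)

theorem memLp_continuous_triangle {F : Type*} [NormedAddCommGroup F]
    [SecondCountableTopologyEither Plane F] (b : AffineBasis (Fin 3) ℝ Plane)
    {f : Plane → F} (hf : Continuous f) :
    MemLp f 2 (volume.restrict (interior (convexHull ℝ (range b)))) := by
  have := isFiniteMeasure_interior_triangle b
  obtain ⟨C, hC⟩ := ((finite_range b).isCompact_convexHull ℝ).exists_bound_of_continuousOn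
    hf.continuousOn
  refine MemLp.of_bound hf.aestronglyMeasurable C ?_
  filter_upwards [ae_restrict_mem isOpen_interior.measurableSet] with x hx
    using hC x (interior_subset hx)

theorem integrable_continuous_triangle {F : Type*} [NormedAddCommGroup F]
    [SecondCountableTopologyEither Plane F] (b : AffineBasis (Fin 3) ℝ Plane)
    {f : Plane → F} (hf : Continuous f) :
    Integrable f (volume.restrict (interior (convexHull ℝ (range b)))) :=
  have := isFiniteMeasure_interior_triangle b
  (memLp_continuous_triangle b hf).integrable (by norm_num)

/-- Green's formula for an affine function. -/
theorem integral_affine_mul_coord_sub_coord (b : AffineBasis (Fin 3) ℝ Plane)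
    (a : Plane →ᵃ[ℝ] ℝ) {i j : Fin 3} (hij : i ≠ j) :
    ∫ x in interior (convexHull ℝ (range b)), a x * (b.coord i x - b.coord j x) =
      (a (b i) - a (b j)) *
        ∫ x in interior (convexHull ℝ (range b)), b.coord i x * b.coord j x := by
  rw [integral_mul_coord_sub_coord b (memLp_continuous_triangle b a.contDiff_plane.continuous)
    (memLp_continuous_triangle b continuous_const) (hasWeakGrad_affine _ a) hij,
    integral_const_mul, inner_affineGrad, ← vsub_eq_sub (b j), AffineMap.linearMap_vsub,
    vsub_eq_sub]
  ring

/-- The second moments of the barycentric coordinates. -/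
theorem integral_coord_mul_coord (b : AffineBasis (Fin 3) ℝ Plane) (i j : Fin 3) :
    ∫ x in interior (convexHull ℝ (range b)), b.coord i x * b.coord j x =
      (volume.real (interior (convexHull ℝ (range b)))) * (if i = j then 1 / 6 else 1 / 12) := by
  set U := interior (convexHull ℝ (range b)) with hU
  set m : Fin 3 → Fin 3 → ℝ := fun i j => ∫ x in U, b.coord i x * b.coord j x with hm
  have hint (i j : Fin 3) : IntegrableOn (fun x => b.coord i x * b.coord j x) U :=
    integrable_continuous_triangle b ((continuous_coord b i).mul (continuous_coord b j))
  have hsymm (i j : Fin 3) : m i j = m j i := by simp only [hm, mul_comm]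
  -- Green's formula for the affine function `λ_l`. With `l ∈ {i, j}` it says that a diagonal moment
  -- is twice an off-diagonal one; with `l` the third index, that off-diagonal moments agree.
  have hrel (i j l : Fin 3) (hij : i ≠ j) :
      m l i - m l j = (b.coord l (b i) - b.coord l (b j)) * m i j := by
    rw [← integral_affine_mul_coord_sub_coord b (b.coord l) hij]
    simp only [hm, mul_sub]
    rw [integral_sub (hint l i) (hint l j)]
  -- Integrating `(∑ λ_i)² = 1` fixes the remaining scale: three moments `2 m` and six moments `m`
  -- add up to the area.
  have hsum : ∑ i, ∑ j, m i j = volume.real U := by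
    simp only [hm]
    simp only [← integral_finsetSum Finset.univ fun i _ => hint _ i]
    rw [← integral_finsetSum Finset.univ fun i _ => integrable_finsetSum _ fun j _ => hint i j]
    simp only [← Finset.mul_sum, b.sum_coord_apply_eq_one, mul_one]
    simp
  have e01 := hrel 0 1 0 (by decide)
  have e01' := hrel 0 1 1 (by decide)
  have e01'' := hrel 0 1 2 (by decide)
  have e02 := hrel 0 2 0 (by decide)
  have e02' := hrel 0 2 1 (by decide)
  have e02'' := hrel 0 2 2 (by decide)
  have s01 := hsymm 0 1
  have s02 := hsymm 0 2
  have s12 := hsymm 1 2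
  simp at e01 e01' e01'' e02 e02' e02''
  simp only [Fin.sum_univ_three] at hsum
  change m i j = _
  fin_cases i <;> fin_cases j <;> simp <;> linarith

/-! ### The quadrature rule on triangles -/

theorem AffineMap.apply_eq_sum_coord {F : Type*} [AddCommGroup F] [Module ℝ F]
    (b : AffineBasis (Fin 3) ℝ Plane) (a : Plane →ᵃ[ℝ] F) (x : Plane) :
    a x = ∑ i, b.coord i x • a (b i) := by
  conv_lhs => rw [← b.affineCombination_coord_eq_self x]
  rw [Finset.map_affineCombination _ _ _ (b.sum_coord_apply_eq_one x),
    Finset.affineCombination_eq_linear_combination _ _ _ (b.sum_coord_apply_eq_one x)]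
  rfl

theorem AffineMap.apply_third_smul {F : Type*} [AddCommGroup F] [Module ℝ F]
    (a : Plane →ᵃ[ℝ] F) (x y z : Plane) :
    a ((1 / 3 : ℝ) • (x + y + z)) = (1 / 3 : ℝ) • (a x + a y + a z) := by
  rw [a.decomp]
  simp only [Pi.add_apply, map_smul, map_add]
  module

/-- The midpoint of a triangle. -/
noncomputable def triMid (b : AffineBasis (Fin 3) ℝ Plane) : Plane :=
  (1 / 3 : ℝ) • (b 0 + b 1 + b 2)

theorem triMid_mem (b : AffineBasis (Fin 3) ℝ Plane) : triMid b ∈ convexHull ℝ (range b) := by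
  rw [AffineBasis.convexHull_eq_nonneg_coord]
  intro i
  rw [triMid, AffineMap.apply_third_smul]
  fin_cases i <;> simp

/-- The error functional of the quadrature rule on a triangle. -/
noncomputable def triError (b : AffineBasis (Fin 3) ℝ Plane) (F : Plane → ℝ) : ℝ :=
  volume.real (interior (convexHull ℝ (range b))) *
      (3 / 4 * F (triMid b) + ∑ i, 1 / 12 * F (b i)) -
    ∫ x in interior (convexHull ℝ (range b)), F x

theorem triError_add (b : AffineBasis (Fin 3) ℝ Plane) {F G : Plane → ℝ} (hF : Continuous F)
    (hG : Continuous G) : triError b (fun x => F x + G x) = triError b F + triError b G := by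
  simp only [triError]
  rw [integral_add (integrable_continuous_triangle b hF) (integrable_continuous_triangle b hG)]
  simp only [mul_add, Finset.sum_add_distrib]
  ring

/-- The quadrature rule is exact for quadratic polynomials. -/
theorem triError_affine_mul_affine (b : AffineBasis (Fin 3) ℝ Plane) (a c : Plane →ᵃ[ℝ] ℝ) :
    triError b (fun x => a x * c x) = 0 := by
  have hint (i j : Fin 3) : IntegrableOn (fun x => b.coord i x * b.coord j x *
      (a (b i) * c (b j))) (interior (convexHull ℝ (range b))) :=
    (integrable_continuous_triangle b
      ((continuous_coord b i).mul (continuous_coord b j))).mul_const _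
  have h : ∫ x in interior (convexHull ℝ (range b)), a x * c x =
      ∑ i, ∑ j, volume.real (interior (convexHull ℝ (range b))) *
        (if i = j then 1 / 6 else 1 / 12) * (a (b i) * c (b j)) := by
    simp only [← integral_coord_mul_coord, ← integral_mul_const]
    simp only [← integral_finsetSum Finset.univ fun i _ => hint _ i]
    rw [← integral_finsetSum Finset.univ fun i _ => integrable_finsetSum _ fun j _ => hint i j]
    congr 1
    funext x
    rw [AffineMap.apply_eq_sum_coord b a x, AffineMap.apply_eq_sum_coord b c x,
      Finset.sum_mul_sum]
    simp only [smul_eq_mul]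
    exact Finset.sum_congr rfl fun i _ => Finset.sum_congr rfl fun j _ => by ring
  -- On `λ_i λ_j` the midpoint contributes `3/4 · 1/9 = 1/12` and the vertices add `1/12` exactly
  -- when `i = j`, which matches the moments.
  rw [triError, h, triMid, AffineMap.apply_third_smul, AffineMap.apply_third_smul]
  simp only [Fin.sum_univ_three, Fin.isValue, Fin.reduceEq, if_true, if_false, smul_eq_mul]
  ring

/-- The components of an affine vector field. -/
noncomputable def affineComp (A : Plane →ᵃ[ℝ] Plane) (i : Fin 2) : Plane →ᵃ[ℝ] ℝ :=
  (EuclideanSpace.proj (𝕜 := ℝ) i : Plane →L[ℝ] ℝ).toLinearMap.toAffineMap.comp A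

theorem affineComp_apply (A : Plane →ᵃ[ℝ] Plane) (i : Fin 2) (x : Plane) :
    affineComp A i x = A x i := rfl

theorem inner_plane (x y : Plane) : ⟪x, y⟫ = x 0 * y 0 + x 1 * y 1 := by
  simp [PiLp.inner_apply, Fin.sum_univ_two, mul_comm]

theorem triError_inner_affine (b : AffineBasis (Fin 3) ℝ Plane) (A B : Plane →ᵃ[ℝ] Plane) :
    triError b (fun x => ⟪A x, B x⟫) = 0 := by
  simp only [inner_plane, ← affineComp_apply]
  have hA (i) := (affineComp A i).contDiff_plane.continuous
  have hB (i) := (affineComp B i).contDiff_plane.continuous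
  rw [triError_add b (by fun_prop) (by fun_prop),
    triError_affine_mul_affine, triError_affine_mul_affine, add_zero]

/-- The weights are positive with sum `1`, so the rule and the integral are each at most `|K| D`. -/
theorem abs_triError_le (b : AffineBasis (Fin 3) ℝ Plane) {F : Plane → ℝ} {D : ℝ}
    (hF : ∀ x ∈ convexHull ℝ (range b), |F x| ≤ D) :
    |triError b F| ≤ 2 * volume.real (interior (convexHull ℝ (range b))) * D := by
  have hV : 0 ≤ volume.real (interior (convexHull ℝ (range b))) := measureReal_nonneg
  have h1 : |∫ x in interior (convexHull ℝ (range b)), F x| ≤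
      D * volume.real (interior (convexHull ℝ (range b))) := by
    have := isFiniteMeasure_interior_triangle b
    have hlt : volume (interior (convexHull ℝ (range b))) < ⊤ := by
      simpa using measure_lt_top (volume.restrict (interior (convexHull ℝ (range b)))) univ
    exact norm_setIntegral_le_of_norm_le_const (f := F) hlt
      fun x hx => hF x (interior_subset hx)
  have hb (i : Fin 3) : |F (b i)| ≤ D := hF _ (subset_convexHull _ _ (mem_range_self i))
  have h2 : |3 / 4 * F (triMid b) + ∑ i, 1 / 12 * F (b i)| ≤ D := by
    rw [Fin.sum_univ_three]
    have e0 := abs_le.1 (hb 0)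
    have e1 := abs_le.1 (hb 1)
    have e2 := abs_le.1 (hb 2)
    have em := abs_le.1 (hF _ (triMid_mem b))
    rw [abs_le]
    constructor <;> linarith
  rw [triError]
  refine (abs_sub _ _).trans ?_
  rw [abs_mul, abs_of_nonneg hV]
  nlinarith [mul_le_mul_of_nonneg_left h2 hV]

/-- The preimage of a ball under an affine map is convex, so it contains the triangle once it
contains the vertices. -/
theorem norm_affine_le_of_vertices {F : Type*} [NormedAddCommGroup F] [NormedSpace ℝ F]
    (b : AffineBasis (Fin 3) ℝ Plane) (a : Plane →ᵃ[ℝ] F) {D : ℝ} (h : ∀ i, ‖a (b i)‖ ≤ D)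
    {x : Plane} (hx : x ∈ convexHull ℝ (range b)) : ‖a x‖ ≤ D := by
  have hs : convexHull ℝ (range b) ⊆ a ⁻¹' closedBall 0 D := by
    refine convexHull_min ?_ ((convex_closedBall _ _).affine_preimage a)
    rintro _ ⟨i, rfl⟩
    simpa using h i
  simpa using hs hx

theorem norm_affine_sub_triMid_le {F : Type*} [NormedAddCommGroup F] [NormedSpace ℝ F]
    (b : AffineBasis (Fin 3) ℝ Plane) (a : Plane →ᵃ[ℝ] F) {D : ℝ}
    (h : ∀ i j, ‖a (b i) - a (b j)‖ ≤ D) {x : Plane} (hx : x ∈ convexHull ℝ (range b)) :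
    ‖a x - a (triMid b)‖ ≤ D := by
  refine norm_affine_le_of_vertices b (a - AffineMap.const ℝ Plane (a (triMid b))) (fun i => ?_) hx
  have e : a (b i) - a (triMid b) =
      (1 / 3 : ℝ) • ((a (b i) - a (b 0)) + (a (b i) - a (b 1)) + (a (b i) - a (b 2))) := by
    rw [triMid, AffineMap.apply_third_smul]
    module
  change ‖a (b i) - a (triMid b)‖ ≤ D
  rw [e, norm_smul]
  have := norm_add₃_le (a := a (b i) - a (b 0)) (b := a (b i) - a (b 1)) (c := a (b i) - a (b 2))
  rw [Real.norm_of_nonneg (by norm_num)]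
  linarith [h i 0, h i 1, h i 2]

/-- The quadrature error of `A · v`, where `A` is affine and `v` is a Raviart-Thomas field: only
the centered cubic part contributes. -/
theorem triError_inner_raviartThomas (b : AffineBasis (Fin 3) ℝ Plane) (A B : Plane →ᵃ[ℝ] Plane)
    (l : Plane →ᵃ[ℝ] ℝ) :
    triError b (fun x => ⟪A x, B x + l x • x⟫) =
      triError b (fun x => (l x - l (triMid b)) * ⟪A x - A (triMid b), x - triMid b⟫) := by
  set m := triMid b
  have hA := A.contDiff_plane.continuous
  have hl := l.contDiff_plane.continuous
  -- Expand `l x = l m + l(m) (x - m) + (l - l(m)) (x - m)`. The first two terms are affine and join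
  -- `B`. In the last one, splitting `A = A(m) + (A - A(m))` gives a product of two affine
  -- functions, `l₁ a₁`, plus the centered cubic.
  let B₁ : Plane →ᵃ[ℝ] Plane :=
    B + (LinearMap.toSpanSingleton ℝ Plane m).toAffineMap.comp l +
      l m • (AffineMap.id ℝ Plane - AffineMap.const ℝ Plane m)
  let l₁ : Plane →ᵃ[ℝ] ℝ := l - AffineMap.const ℝ Plane (l m)
  let a₁ : Plane →ᵃ[ℝ] ℝ :=
    (innerₗ Plane (A m)).toAffineMap.comp (AffineMap.id ℝ Plane - AffineMap.const ℝ Plane m)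
  have hB₁ (x : Plane) : B₁ x = B x + l x • m + l m • (x - m) := rfl
  have hl₁ (x : Plane) : l₁ x = l x - l m := rfl
  have ha₁ (x : Plane) : a₁ x = ⟪A m, x - m⟫ := rfl
  have e : (fun x => ⟪A x, B x + l x • x⟫) = fun x => (⟪A x, B₁ x⟫ + l₁ x * a₁ x) +
      (l x - l m) * ⟪A x - A m, x - m⟫ := by
    funext x
    rw [hB₁, hl₁, ha₁]
    simp only [inner_plane, PiLp.add_apply, PiLp.sub_apply, PiLp.smul_apply, smul_eq_mul]
    ring
  have hB₁c := B₁.contDiff_plane.continuous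
  have hl₁c := l₁.contDiff_plane.continuous
  have ha₁c := a₁.contDiff_plane.continuous
  rw [e, triError_add b (by fun_prop) (by fun_prop), triError_add b (by fun_prop) (by fun_prop),
    triError_inner_affine, triError_affine_mul_affine, zero_add, zero_add]

/-! ### The divergence of Raviart-Thomas fields -/

/-- In the plane `div (l x) = 2 l + x · ∇l`, and `x · ∇l = l(x) - l(0)` because `l` is affine. -/
theorem divergence_raviartThomas (B : Plane →ᵃ[ℝ] Plane) (l : Plane →ᵃ[ℝ] ℝ) :
    ∃ c : ℝ, ∀ x, divergence (fun x => B x + l x • x) x = 3 * l x + c := by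
  refine ⟨∑ i, B.linear (EuclideanSpace.single i 1) i - l 0, fun x => ?_⟩
  have h := (B.hasFDerivAt_plane x).add ((l.hasFDerivAt_plane x).smul (hasFDerivAt_id x))
  have hx : x = x 0 • EuclideanSpace.single 0 1 + x 1 • EuclideanSpace.single 1 1 := by
    ext i
    fin_cases i <;> simp
  have hlx : l x = l.linear x + l 0 := congrFun l.decomp x
  have hlin : l.linear x = x 0 * l.linear (EuclideanSpace.single 0 1) +
      x 1 * l.linear (EuclideanSpace.single 1 1) := by
    conv_lhs => rw [hx]
    simp
  have h' : fderiv ℝ (fun x => B x + l x • x) x = _ := h.fderiv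
  simp only [divergence, h']
  simp [Fin.sum_univ_two]
  linarith

/-- The oscillation of `l` is controlled by the divergence of `B + l x`. -/
theorem sq_sub_triMid_le (b : AffineBasis (Fin 3) ℝ Plane) (l : Plane →ᵃ[ℝ] ℝ) (c : ℝ)
    (i : Fin 3) :
    volume.real (interior (convexHull ℝ (range b))) * (l (b i) - l (triMid b)) ^ 2 ≤
      4 * ∫ x in interior (convexHull ℝ (range b)), (3 * l x + c) ^ 2 := by
  have hV : 0 ≤ volume.real (interior (convexHull ℝ (range b))) := measureReal_nonneg
  let d : Plane →ᵃ[ℝ] ℝ := (3 : ℝ) • l + AffineMap.const ℝ Plane c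
  have hd (x : Plane) : d x = 3 * l x + c := rfl
  have h := triError_affine_mul_affine b d d
  rw [triError, sub_eq_zero] at h
  simp only [hd, ← pow_two] at h
  rw [← h, ← mul_assoc, mul_comm (4 : ℝ), mul_assoc]
  refine mul_le_mul_of_nonneg_left ?_ hV
  -- Here `3 (x - s)` is the difference of the values of `3 l + c` at a vertex and at the midpoint.
  -- Both squared values occur in the quadrature sum with positive weight.
  have key (x s : ℝ) :
      (x - s) ^ 2 ≤ 4 * (3 / 4 * (3 * s + c) ^ 2 + 1 / 12 * (3 * x + c) ^ 2) := by
    nlinarith [sq_nonneg (x - s), sq_nonneg (3 * s + c), sq_nonneg (x - s + (3 * s + c))]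
  refine (key (l (b i)) (l (triMid b))).trans ?_
  gcongr
  exact Finset.single_le_sum (f := fun i => 1 / 12 * (3 * l (b i) + c) ^ 2)
    (fun j _ => by positivity) (Finset.mem_univ i)

/-! ### Stability of the projection -/

theorem sq_integral_le_measureReal_mul {α : Type*} [MeasurableSpace α] {μ : Measure α}
    [IsFiniteMeasure μ] {f : α → ℝ} (hf : MemLp f 2 μ) :
    (∫ x, f x ∂μ) ^ 2 ≤ μ.real univ * ∫ x, f x ^ 2 ∂μ := by
  rcases eq_or_ne (μ.real univ) 0 with h0 | h0
  · have : μ = 0 := by simpa [measureReal_def, ENNReal.toReal_eq_zero_iff] using h0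
    simp [this]
  · set V := μ.real univ with hV
    have hVpos : 0 < V := lt_of_le_of_ne measureReal_nonneg h0.symm
    have hfi : Integrable f μ := hf.integrable (by norm_num)
    have hsq : Integrable (fun x => f x ^ 2) μ := hf.integrable_sq
    set I := ∫ x, f x ∂μ with hI
    -- Cauchy–Schwarz as nonnegativity of the variance, scaled by `V` to avoid division.
    have h : 0 ≤ ∫ x, (V * f x - I) ^ 2 ∂μ := integral_nonneg fun x => sq_nonneg _
    have e : (fun x => (V * f x - I) ^ 2) =
        fun x => (V ^ 2 * f x ^ 2 - 2 * V * I * f x) + I ^ 2 := by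
      funext x
      ring
    have h1 : Integrable (fun x => V ^ 2 * f x ^ 2 - 2 * V * I * f x) μ :=
      (hsq.const_mul _).sub (hfi.const_mul _)
    rw [e, integral_add h1 (integrable_const _), integral_sub (hsq.const_mul _) (hfi.const_mul _), integral_const_mul, integral_const_mul,
      integral_const, ← hI, ← hV, smul_eq_mul] at h
    have h' : 0 ≤ V * (V * ∫ x, f x ^ 2 ∂μ - I ^ 2) := by linarith
    exact sub_nonneg.1 (nonneg_of_mul_nonneg_right h' hVpos)

theorem measureReal_interior_triangle_pos (b : AffineBasis (Fin 3) ℝ Plane) :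
    0 < volume.real (interior (convexHull ℝ (range b))) := by
  have := isFiniteMeasure_interior_triangle b
  have hne := isOpen_interior.measure_pos volume ⟨_, b.centroid_mem_interior_convexHull⟩
  have hlt : volume (interior (convexHull ℝ (range b))) < ⊤ := by
    simpa using measure_lt_top (volume.restrict (interior (convexHull ℝ (range b)))) univ
  exact ENNReal.toReal_pos hne.ne' hlt.ne

/-- The differences of the vertex values of an affine function, which has the same
moments against affine functions as `f`, are bounded by the weak gradient of `f`. -/
theorem sq_affine_sub_le_weakGrad (b : AffineBasis (Fin 3) ℝ Plane) {f : Plane → ℝ}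
    {g : Plane → Plane} {a : Plane →ᵃ[ℝ] ℝ}
    (hf : MemLp f 2 (volume.restrict (interior (convexHull ℝ (range b)))))
    (hg : MemLp g 2 (volume.restrict (interior (convexHull ℝ (range b)))))
    (hfg : HasWeakGrad (interior (convexHull ℝ (range b))) f g)
    (hfa : ∀ q : Plane →ᵃ[ℝ] ℝ,
      ∫ x in interior (convexHull ℝ (range b)), (f x - a x) * q x = 0)
    {h : ℝ} (hh : ∀ i j, ‖b i - b j‖ ≤ h) (i j : Fin 3) :
    volume.real (interior (convexHull ℝ (range b))) * (a (b i) - a (b j)) ^ 2 ≤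
      144 * h ^ 2 * ∫ x in interior (convexHull ℝ (range b)), ‖g x‖ ^ 2 := by
  have hG : 0 ≤ ∫ x in interior (convexHull ℝ (range b)), ‖g x‖ ^ 2 :=
    integral_nonneg fun x => by positivity
  rcases eq_or_ne i j with rfl | hij
  · simpa using mul_nonneg (by positivity : 0 ≤ 144 * h ^ 2) hG
  have := isFiniteMeasure_interior_triangle b
  set U := interior (convexHull ℝ (range b)) with hU
  set V := volume.real U with hVdef
  have hV : 0 < V := measureReal_interior_triangle_pos b
  have hh0 : 0 ≤ h := (norm_nonneg _).trans (hh 0 0)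
  -- Since `λ_i - λ_j` is affine, it is an admissible test function in `hfa`.
  have hq : ∫ x in U, f x * (b.coord i x - b.coord j x) =
      ∫ x in U, a x * (b.coord i x - b.coord j x) := by
    have h1 := hfa (b.coord i - b.coord j)
    have hc : MemLp (fun x => b.coord i x - b.coord j x) 2 (volume.restrict U) :=
      memLp_continuous_triangle b ((continuous_coord b i).sub (continuous_coord b j))
    have ha : MemLp a 2 (volume.restrict U) :=
      memLp_continuous_triangle b a.contDiff_plane.continuous
    have hfc : Integrable (fun x => f x * (b.coord i x - b.coord j x)) (volume.restrict U) :=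
      hf.integrable_mul hc
    have hac : Integrable (fun x => a x * (b.coord i x - b.coord j x)) (volume.restrict U) :=
      ha.integrable_mul hc
    rw [← sub_eq_zero, ← integral_sub hfc hac, ← h1]
    simp only [sub_mul]
    rfl
  -- The factor `1/12` is the moment of `λ_i λ_j`; squaring it produces the constant `144`.
  have hmain : (a (b i) - a (b j)) * (V * (1 / 12)) =
      -∫ x in U, ⟪g x, b j - b i⟫ * (b.coord i x * b.coord j x) := by
    rw [← integral_mul_coord_sub_coord b hf hg hfg hij, hq,
      integral_affine_mul_coord_sub_coord b a hij, integral_coord_mul_coord, if_neg hij]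
  have hgn : MemLp (fun x => ‖g x‖) 2 (volume.restrict U) := hg.norm
  have hgi : Integrable (fun x => ‖g x‖) (volume.restrict U) := hgn.integrable (by norm_num)
  have hbound : |∫ x in U, ⟪g x, b j - b i⟫ * (b.coord i x * b.coord j x)| ≤
      h * ∫ x in U, ‖g x‖ := by
    rw [← integral_const_mul, ← Real.norm_eq_abs]
    refine norm_integral_le_of_norm_le (hgi.const_mul h) ?_
    filter_upwards [ae_restrict_mem isOpen_interior.measurableSet] with x hx
    have hi := coord_mem_of_mem_interior b hx i
    have hj := coord_mem_of_mem_interior b hx j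
    rw [norm_mul, Real.norm_of_nonneg (mul_pos hi.1 hj.1).le]
    refine (mul_le_of_le_one_right (norm_nonneg _) (mul_le_one₀ hi.2 hj.1.le hj.2)).trans ?_
    refine (norm_inner_le_norm _ _).trans ?_
    rw [mul_comm]
    exact mul_le_mul_of_nonneg_right (hh j i) (norm_nonneg _)
  have hCS := sq_integral_le_measureReal_mul hgn
  rw [measureReal_restrict_apply_univ, ← hVdef] at hCS
  have h2 : ((a (b i) - a (b j)) * (V * (1 / 12))) ^ 2 ≤ (h * ∫ x in U, ‖g x‖) ^ 2 := by
    rw [hmain, neg_sq]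
    exact sq_le_sq' (abs_le.1 hbound).1 (abs_le.1 hbound).2
  rw [mul_pow h] at h2
  have h3 := h2.trans (mul_le_mul_of_nonneg_left hCS (sq_nonneg h))
  have h4 : V * (V * (a (b i) - a (b j)) ^ 2) ≤ V * (144 * h ^ 2 * ∫ x in U, ‖g x‖ ^ 2) := by
    nlinarith
  exact le_of_mul_le_mul_left h4 hV

theorem norm_sq_plane (x : Plane) : ‖x‖ ^ 2 = x 0 ^ 2 + x 1 ^ 2 := by
  simp [EuclideanSpace.norm_sq_eq, Fin.sum_univ_two]

/-- The `L²`-projection onto the affine fields is stable with respect to the gradient. -/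
theorem sq_norm_proj_sub_le_h1Norm (b : AffineBasis (Fin 3) ℝ Plane) {u : Plane → Plane}
    {p : Plane →ᵃ[ℝ] Plane}
    (hu : MemH1Vec (interior (convexHull ℝ (range b))) u)
    (hup : ∀ q : Plane →ᵃ[ℝ] Plane,
      ∫ x in interior (convexHull ℝ (range b)), ⟪u x - p x, q x⟫ = 0)
    {h : ℝ} (hh : ∀ i j, ‖b i - b j‖ ≤ h) (i j : Fin 3) :
    volume.real (interior (convexHull ℝ (range b))) * ‖p (b i) - p (b j)‖ ^ 2 ≤
      144 * h ^ 2 * h1Norm (interior (convexHull ℝ (range b))) u ^ 2 := by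
  set U := interior (convexHull ℝ (range b)) with hU
  have key (n : Fin 2) : volume.real U * (p (b i) n - p (b j) n) ^ 2 ≤
      144 * h ^ 2 * ∫ x in U, ‖weakGrad U (fun y => u y n) x‖ ^ 2 := by
    have hw : MemLp (weakGrad U (fun y => u y n)) 2 (volume.restrict U) ∧
        HasWeakGrad U (fun y => u y n) (weakGrad U (fun y => u y n)) := by
      rw [weakGrad, dif_pos (hu n)]
      exact (hu n).2.choose_spec
    refine sq_affine_sub_le_weakGrad b (a := affineComp p n) (hu n).1 hw.1 hw.2 (fun q => ?_) hh i j
    -- Testing with the field `q e_n` isolates the component `n`.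
    rw [← hup ((LinearMap.toSpanSingleton ℝ Plane
      (EuclideanSpace.single n 1)).toAffineMap.comp q)]
    refine integral_congr_ae (Filter.Eventually.of_forall fun x => ?_)
    change (u x n - p x n) * q x = ⟪u x - p x, q x • EuclideanSpace.single n (1 : ℝ)⟫
    rw [inner_smul_right, EuclideanSpace.inner_single_right]
    simp [mul_comm]
  have hH : (∑ n : Fin 2, ∫ x in U, ‖weakGrad U (fun y => u y n) x‖ ^ 2) ≤ h1Norm U u ^ 2 := by
    rw [h1Norm, Real.sq_sqrt]
    · refine Finset.sum_le_sum fun n _ => le_add_of_nonneg_left ?_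
      exact integral_nonneg fun x => sq_nonneg _
    · exact Finset.sum_nonneg fun n _ => add_nonneg (integral_nonneg fun x => sq_nonneg _)
        (integral_nonneg fun x => sq_nonneg _)
  rw [norm_sq_plane, mul_add]
  refine (add_le_add (key 0) (key 1)).trans ?_
  rw [← mul_add, ← Fin.sum_univ_two (f := fun n => ∫ x in U, ‖weakGrad U (fun y => u y n) x‖ ^ 2)]
  exact mul_le_mul_of_nonneg_left hH (by positivity)

theorem le_div_sqrt_of_mul_sq_le {V x y : ℝ} (hV : 0 < V) (hy : 0 ≤ y)
    (h : V * x ^ 2 ≤ y ^ 2) : x ≤ y / √V := by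
  rw [le_div_iff₀ (Real.sqrt_pos.2 hV)]
  refine (abs_le_of_sq_le_sq' ?_ hy).2
  rw [mul_pow, Real.sq_sqrt hV.le]
  linarith

/-- The quadrature error of the projection of an `H¹` field against a Raviart-Thomas field. -/
theorem abs_triError_proj_le (b : AffineBasis (Fin 3) ℝ Plane) {u : Plane → Plane}
    {p : Plane →ᵃ[ℝ] Plane}
    (hu : MemH1Vec (interior (convexHull ℝ (range b))) u)
    (hup : ∀ q : Plane →ᵃ[ℝ] Plane,
      ∫ x in interior (convexHull ℝ (range b)), ⟪u x - p x, q x⟫ = 0)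
    {h : ℝ} (hh : ∀ i j, ‖b i - b j‖ ≤ h) (B : Plane →ᵃ[ℝ] Plane) (l : Plane →ᵃ[ℝ] ℝ) :
    |triError b (fun x => ⟪p x, B x + l x • x⟫)| ≤
      48 * h ^ 2 * h1Norm (interior (convexHull ℝ (range b))) u *
        l2Norm (interior (convexHull ℝ (range b))) (divergence fun x => B x + l x • x) := by
  have hH : 0 ≤ h1Norm (interior (convexHull ℝ (range b))) u := Real.sqrt_nonneg _
  obtain ⟨c, hc⟩ := divergence_raviartThomas B l
  set U := interior (convexHull ℝ (range b)) with hU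
  set V := volume.real U with hVdef
  set H := h1Norm U u with hHdef
  set d := l2Norm U (divergence fun x => B x + l x • x) with hd
  have hV : 0 < V := measureReal_interior_triangle_pos b
  have hh0 : 0 ≤ h := (norm_nonneg _).trans (hh 0 0)
  have hd0 : 0 ≤ d := Real.sqrt_nonneg _
  have hd2 : ∫ x in U, (3 * l x + c) ^ 2 = d ^ 2 := by
    rw [hd, l2Norm, Real.sq_sqrt (integral_nonneg fun x => sq_nonneg _)]
    simp only [hc]
  have hl (x : Plane) (hx : x ∈ convexHull ℝ (range b)) :
      |l x - l (triMid b)| ≤ 2 * d / √V := by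
    refine norm_affine_le_of_vertices b (l - AffineMap.const ℝ Plane (l (triMid b)))
      (fun i => le_div_sqrt_of_mul_sq_le hV (by positivity) ?_) hx
    have := sq_sub_triMid_le b l c i
    rw [hd2] at this
    change V * |l (b i) - l (triMid b)| ^ 2 ≤ _
    rw [sq_abs]
    linarith
  have hp (x : Plane) (hx : x ∈ convexHull ℝ (range b)) :
      ‖p x - p (triMid b)‖ ≤ 12 * h * H / √V := by
    refine norm_affine_sub_triMid_le b p
      (fun i j => le_div_sqrt_of_mul_sq_le hV (by positivity) ?_) hx
    have := sq_norm_proj_sub_le_h1Norm b hu hup hh i j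
    nlinarith
  have hy (x : Plane) (hx : x ∈ convexHull ℝ (range b)) : ‖x - triMid b‖ ≤ h :=
    norm_affine_sub_triMid_le b (AffineMap.id ℝ Plane) hh hx
  rw [triError_inner_raviartThomas]
  -- The factors are `2` from the rule and the integral, `2` from the divergence bound and `12` from
  -- the projection bound, so the constant is `48`; the two factors `1 / √V` absorb the area.
  refine (abs_triError_le b (D := 2 * d / √V * (12 * h * H / √V * h)) fun x hx => ?_).trans
    (le_of_eq ?_)
  · rw [abs_mul]
    refine mul_le_mul (hl x hx) ?_ (abs_nonneg _) (by positivity)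
    exact (abs_real_inner_le_norm _ _).trans
      (mul_le_mul (hp x hx) (hy x hx) (norm_nonneg _) (by positivity))
  · have hs : √V ≠ 0 := (Real.sqrt_pos.2 hV).ne'
    rw [← hVdef]
    nth_rewrite 1 [← Real.mul_self_sqrt hV.le]
    field_simp
    ring

/-! ### The quadrature rule on parallelograms -/

/-- Change of variables from the unit square to a parallelogram. -/
theorem exists_integral_parallelogram_eq (o a b : Plane) (hab : LinearIndependent ℝ ![a, b]) :
    ∃ c : ℝ, ∀ F : Plane → ℝ, ∫ x in (Cell.parallelogram o a b hab).carrier, F x =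
      c * ∫ z in Icc (0 : ℝ) 1 ×ˢ Icc (0 : ℝ) 1, F (o + z.1 • a + z.2 • b) := by
  let L : (ℝ × ℝ) →ₗ[ℝ] Plane :=
    (LinearMap.toSpanSingleton ℝ Plane a).coprod (LinearMap.toSpanSingleton ℝ Plane b)
  have hL (z : ℝ × ℝ) : L z = z.1 • a + z.2 • b := by simp [L]
  have hinj : Function.Injective L := by
    rw [← LinearMap.ker_eq_bot, LinearMap.ker_eq_bot']
    intro z hz
    rw [hL] at hz
    obtain ⟨h1, h2⟩ := LinearIndependent.pair_iff.1 hab _ _ hz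
    exact Prod.ext h1 h2
  let e : (ℝ × ℝ) ≃L[ℝ] Plane :=
    (LinearEquiv.ofInjectiveOfFinrankEq L hinj (by simp)).toContinuousLinearEquiv
  have he (z : ℝ × ℝ) : e z = z.1 • a + z.2 • b := hL z
  let ψ : (ℝ × ℝ) ≃ₜ Plane := e.toHomeomorph.trans (Homeomorph.addLeft o)
  have hψ (z : ℝ × ℝ) : ψ z = o + z.1 • a + z.2 • b := by
    rw [add_assoc, ← he]
    rfl
  -- Uniqueness of Haar measure up to scaling replaces a Jacobian computation; the translation by
  -- `o` does not change the measure.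
  have hμ : ∃ c : NNReal, (volume : Measure Plane) = c • Measure.map ψ volume := by
    have : (Measure.map e (volume : Measure (ℝ × ℝ))).IsAddHaarMeasure :=
      e.isAddHaarMeasure_map _
    have h1 : Measure.map ψ (volume : Measure (ℝ × ℝ)) = Measure.map e volume := by
      have h2 : Measure.map ψ (volume : Measure (ℝ × ℝ)) =
          Measure.map (fun x => o + x) (Measure.map e volume) := by
        rw [Measure.map_map (measurable_const_add o) e.continuous.measurable]
        rfl
      rw [h2, map_add_left_eq_self]
    rw [h1]
    exact ⟨_, Measure.isAddLeftInvariant_eq_smul _ _⟩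
  obtain ⟨c, hc⟩ := hμ
  refine ⟨c, fun F => ?_⟩
  have hpre : ψ ⁻¹' (Cell.parallelogram o a b hab).carrier = Icc (0 : ℝ) 1 ×ˢ Icc (0 : ℝ) 1 := by
    ext z
    simp only [mem_preimage, Cell.carrier, mem_ofPred_eq, mem_prod]
    constructor
    · rintro ⟨s, hs, t, ht, h⟩
      have : z = (s, t) := ψ.injective (by rw [h, hψ])
      subst this
      exact ⟨hs, ht⟩
    · exact fun h => ⟨z.1, h.1, z.2, h.2, hψ z⟩
  conv_lhs => rw [hc]
  rw [Measure.restrict_smul, integral_smul_nnreal_measure,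
    ψ.measurableEmbedding.setIntegral_map, hpre]
  simp only [hψ]
  rfl

theorem integral_unitSquare_monomial (i j : ℕ) :
    ∫ z in Icc (0 : ℝ) 1 ×ˢ Icc (0 : ℝ) 1, z.1 ^ i * z.2 ^ j =
      1 / ((i : ℝ) + 1) * (1 / ((j : ℝ) + 1)) := by
  have h (n : ℕ) : ∫ s in Icc (0 : ℝ) 1, s ^ n = 1 / ((n : ℝ) + 1) := by
    rw [integral_Icc_eq_integral_Ioc, ← intervalIntegral.integral_of_le zero_le_one,
      integral_pow]
    simp
  rw [← h, ← h]
  exact setIntegral_prod_mul (fun s : ℝ => s ^ i) (fun t : ℝ => t ^ j) _ _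

/-- The quadrature rule on the unit square is exact for cubic polynomials. -/
theorem integral_unitSquare_cubic (c : Fin 10 → ℝ) {P : ℝ → ℝ → ℝ}
    (hP : ∀ s t, P s t = c 0 + c 1 * s + c 2 * t + c 3 * s ^ 2 + c 4 * (s * t) + c 5 * t ^ 2 +
      c 6 * s ^ 3 + c 7 * (s ^ 2 * t) + c 8 * (s * t ^ 2) + c 9 * t ^ 3) :
    ∫ z in Icc (0 : ℝ) 1 ×ˢ Icc (0 : ℝ) 1, P z.1 z.2 =
      2 / 3 * P (1 / 2) (1 / 2) + 1 / 12 * (P 0 0 + P 1 0 + P 0 1 + P 1 1) := by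
  -- Exponents of `s` and `t` in the ten monomials, in the order of the coefficients `c`.
  let e : Fin 10 → ℕ := ![0, 1, 0, 2, 1, 0, 3, 2, 1, 0]
  let f : Fin 10 → ℕ := ![0, 0, 1, 0, 1, 2, 0, 1, 2, 3]
  have hsum (z : ℝ × ℝ) : P z.1 z.2 = ∑ n, c n * (z.1 ^ e n * z.2 ^ f n) := by
    rw [hP]
    simp [e, f, Fin.sum_univ_succ]
    ring
  have hint (n : Fin 10) : IntegrableOn (fun z : ℝ × ℝ => c n * (z.1 ^ e n * z.2 ^ f n))
      (Icc (0 : ℝ) 1 ×ˢ Icc (0 : ℝ) 1) :=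
    ContinuousOn.integrableOn_compact (isCompact_Icc.prod isCompact_Icc)
      (by fun_prop)
  simp only [hsum]
  rw [integral_finsetSum _ fun n _ => hint n]
  simp only [integral_const_mul, integral_unitSquare_monomial, hP]
  simp [e, f, Fin.sum_univ_succ]
  ring

theorem sigma_parallelogram_eq_zero (o a b : Plane) (hab : LinearIndependent ℝ ![a, b])
    (A : Plane →ᵃ[ℝ] Plane) {v : Plane → Plane}
    (hv : v ∈ (Cell.parallelogram o a b hab).space) :
    (Cell.parallelogram o a b hab).sigma A v = 0 := by
  obtain ⟨c, d, hv⟩ := hv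
  obtain ⟨J, hJ⟩ := exists_integral_parallelogram_eq o a b hab
  -- Taking the integrand `1` identifies the unspecified scaling factor with the area.
  have harea : (Cell.parallelogram o a b hab).area = J := by
    have h1 := hJ fun _ => 1
    have h2 := integral_unitSquare_monomial 0 0
    simp only [pow_zero, mul_one] at h2
    rw [h2] at h1
    simpa [Cell.area] using h1
  let P : ℝ → ℝ → ℝ := fun s t => ⟪A (o + s • a + t • b), v (o + s • a + t • b)⟫
  have hA (s t : ℝ) : A (o + s • a + t • b) = A o + s • A.linear a + t • A.linear b := by
    rw [A.decomp]
    simp only [Pi.add_apply, map_add, map_smul]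
    module
  -- The coefficients of `A · v` in the reference coordinates `(s, t)`, obtained by multiplying out
  -- the affine `A` and the quadratic `v`.
  have hP := integral_unitSquare_cubic (P := P)
    ![⟪A o, a⟫ * c 0 + ⟪A o, b⟫ * d 0,
      ⟪A o, a⟫ * c 1 + ⟪A.linear a, a⟫ * c 0 + ⟪A o, b⟫ * d 1 + ⟪A.linear a, b⟫ * d 0,
      ⟪A o, a⟫ * c 2 + ⟪A.linear b, a⟫ * c 0 + ⟪A o, b⟫ * d 2 + ⟪A.linear b, b⟫ * d 0,
      ⟪A o, a⟫ * c 3 + ⟪A.linear a, a⟫ * c 1 + ⟪A.linear a, b⟫ * d 1,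
      ⟪A o, a⟫ * c 4 + ⟪A.linear a, a⟫ * c 2 + ⟪A.linear b, a⟫ * c 1 +
        ⟪A o, b⟫ * d 4 + ⟪A.linear a, b⟫ * d 2 + ⟪A.linear b, b⟫ * d 1,
      ⟪A.linear b, a⟫ * c 2 + ⟪A o, b⟫ * d 3 + ⟪A.linear b, b⟫ * d 2,
      ⟪A.linear a, a⟫ * c 3,
      ⟪A.linear a, a⟫ * c 4 + ⟪A.linear b, a⟫ * c 3 + ⟪A.linear a, b⟫ * d 4,
      ⟪A.linear b, a⟫ * c 4 + ⟪A.linear b, b⟫ * d 4 + ⟪A.linear a, b⟫ * d 3,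
      ⟪A.linear b, b⟫ * d 3] fun s t => by
        simp only [P, hv, hA, inner_add_left, inner_add_right, real_inner_smul_left,
          real_inner_smul_right]
        simp
        ring
  have hm : o + (1 / 2 : ℝ) • (a + b) = o + (1 / 2 : ℝ) • a + (1 / 2 : ℝ) • b := by module
  rw [Cell.sigma, Cell.lumped, harea, hJ, sub_eq_zero, hm]
  change _ = J * ∫ z in Icc (0 : ℝ) 1 ×ˢ Icc (0 : ℝ) 1, P z.1 z.2
  rw [hP]
  simp only [P, zero_smul, one_smul, add_zero]
  ring

/-! ### The estimate on a mesh -/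

theorem diam_le_meshSize {T : Finset Cell} {K : Cell} (hK : K ∈ T) : K.diam ≤ meshSize T :=
  le_ciSup (f := fun K : {K // K ∈ T} => K.1.diam) (finite_range _).bddAbove ⟨K, hK⟩

theorem Cell.convex_carrier (K : Cell) : Convex ℝ K.carrier := by
  cases K with
  | triangle p hp => exact convex_convexHull ℝ _
  | parallelogram o a b hab =>
    rintro _ ⟨s, hs, t, ht, rfl⟩ _ ⟨s', hs', t', ht', rfl⟩ x y hx hy hxy
    refine ⟨_, convex_Icc 0 1 hs hs' hx hy hxy, _, convex_Icc 0 1 ht ht' hx hy hxy, ?_⟩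
    have ho : o = x • o + y • o := by rw [← add_smul, hxy, one_smul]
    nth_rewrite 3 [ho]
    simp only [smul_eq_mul]
    module

/-- The frontier of a convex set is null. This passes between the open interior, where weak
gradients live, and the closed cell, where the projection and the quadrature error are defined. -/
theorem Cell.restrict_interior_carrier (K : Cell) :
    (volume : Measure Plane).restrict (interior K.carrier) = volume.restrict K.carrier :=
  Measure.restrict_congr_set
    (interior_ae_eq_of_null_frontier (K.convex_carrier.addHaar_frontier volume))

theorem Cell.isL2Proj_l2Proj (K : Cell) {u : Plane → Plane}
    (hu : MemH1Vec (interior K.carrier) u) : K.IsL2Proj u (K.l2Proj u) := by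
  have h := K.exists_isL2Proj u (by
    rw [← K.restrict_interior_carrier]
    exact MemLp.of_eval_piLp fun i => (hu i).1)
  rw [Cell.l2Proj, dif_pos h]
  exact h.choose_spec

/-- `Cell.restr` is picked by choice; the estimates hold for every element of the local space, so
membership is all that is needed. -/
theorem Cell.restr_mem_space (K : Cell) {v : Plane → Plane}
    (hv : ∃ p ∈ K.space, v =ᵐ[volume.restrict K.carrier] p) : K.restr v ∈ K.space := by
  rw [Cell.restr, dif_pos hv]
  exact hv.choose_spec.1

/-- A nondegenerate triangle as an affine basis of the plane. -/
noncomputable def triBasis (p : Fin 3 → Plane) (hp : AffineIndependent ℝ p) :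
    AffineBasis (Fin 3) ℝ Plane :=
  ⟨p, hp, hp.affineSpan_eq_top_iff_card_eq_finrank_add_one.2 (by simp)⟩

theorem coe_triBasis (p : Fin 3 → Plane) (hp : AffineIndependent ℝ p) : ⇑(triBasis p hp) = p := rfl

theorem sigma_triangle_eq_triError (p : Fin 3 → Plane) (hp : AffineIndependent ℝ p)
    (f g : Plane → Plane) :
    (Cell.triangle p hp).sigma f g = triError (triBasis p hp) (fun x => ⟪f x, g x⟫) := by
  have h : (volume : Measure Plane).restrict (interior (convexHull ℝ (range p))) =
      volume.restrict (convexHull ℝ (range p)) := (Cell.triangle p hp).restrict_interior_carrier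
  have hV : (volume : Measure Plane).real (interior (convexHull ℝ (range p))) =
      volume.real (convexHull ℝ (range p)) := by
    rw [← measureReal_restrict_apply_univ, h, measureReal_restrict_apply_univ]
  rw [triError, coe_triBasis, h, hV]
  rfl

theorem abs_sigma_triangle_le (p : Fin 3 → Plane) (hp : AffineIndependent ℝ p)
    {u v : Plane → Plane} (hu : MemH1Vec (interior (Cell.triangle p hp).carrier) u)
    (hv : v ∈ (Cell.triangle p hp).space) {h : ℝ} (hh : (Cell.triangle p hp).diam ≤ h) :
    |(Cell.triangle p hp).sigma ((Cell.triangle p hp).l2Proj u) v| ≤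
      48 * h ^ 2 * h1Norm (interior (Cell.triangle p hp).carrier) u *
        l2Norm (Cell.triangle p hp).carrier (divergence v) := by
  obtain ⟨B, l, hBl⟩ := hv
  obtain rfl : v = fun x => B x + l x • x := funext hBl
  have hproj := (Cell.triangle p hp).isL2Proj_l2Proj hu
  have hr := (Cell.triangle p hp).restrict_interior_carrier
  have hn : l2Norm (Cell.triangle p hp).carrier (divergence fun x => B x + l x • x) =
      l2Norm (interior (Cell.triangle p hp).carrier) (divergence fun x => B x + l x • x) := by
    rw [l2Norm, l2Norm, hr]
  rw [sigma_triangle_eq_triError, hn]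
  refine abs_triError_proj_le (triBasis p hp) hu (fun q => ?_) (fun i j => ?_) B l
  · rw [← hproj q, ← hr]
    rfl
  · rw [← dist_eq_norm]
    refine (dist_le_diam_of_mem (Cell.isCompact_carrier _).isBounded ?_ ?_).trans hh <;>
      exact subset_convexHull _ _ (mem_range_self _)

theorem mainTheorem3 (γ : ℝ) (hγ : 0 < γ) :
    ∃ C : ℝ, 0 < C ∧
      ∀ (Ω : Set Plane) (T : Finset Cell),
        IsPolygonalLipschitzDomain Ω → IsMesh Ω T → IsQuasiUniform γ T →
      ∀ u : Plane → Plane, MemLp u 2 (volume.restrict Ω) →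
        (∀ K ∈ T, MemH1Vec (interior K.carrier) u) →
      ∀ v : Plane → Plane, MemVh Ω T v →
        (∀ (p : Fin 3 → Plane) (hp : AffineIndependent ℝ p) (K : Cell),
          K = Cell.triangle p hp → K ∈ T →
          |K.sigma (K.l2Proj u) (K.restr v)| ≤
            C * meshSize T ^ 2 * h1Norm (interior K.carrier) u *
              l2Norm K.carrier (divergence (K.restr v))) ∧
        (∀ (o a b : Plane) (hab : LinearIndependent ℝ ![a, b]) (K : Cell),
          K = Cell.parallelogram o a b hab → K ∈ T →
          |K.sigma (K.l2Proj u) (K.restr v)| = 0) := by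
  refine ⟨48, by norm_num, fun Ω T _ _ _ u _ hu v hv => ⟨?_, ?_⟩⟩
  · rintro p hp K rfl hK
    exact abs_sigma_triangle_le p hp (hu _ hK) (Cell.restr_mem_space _ (hv.2 _ hK))
      (diam_le_meshSize hK)
  · rintro o a b hab K rfl hK
    rw [sigma_parallelogram_eq_zero o a b hab _ (Cell.restr_mem_space _ (hv.2 _ hK)), abs_zero]
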